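/- Let $D$ be a directed multigraph with finite vertex set $V(D)$ (loops and parallel edges are allowed), let $X \subseteq V(D)$, and let $k \geq 0$ be an integer. An $X$-path is a directed path in $D$ with at least one edge and without repeated vertices whose first and last vertices lie in $X$ and which contains no other vertex of $X$. Then $D$ admits $k$ pairwise (vertex-)disjoint $X$-paths if and only if all $S, T \subseteq V(D)$ with $X \cap S = X \cap T$ satisfy $$|S \cap T| + \sum_{C} \left\lfloor \tfrac{1}{2} |V(C) \cap (X \cup S \cup T)| \right\rfloor \geq k,$$ where $C$ ranges over the weak components of the spanning directed submultigraph of $D$ obtained by deleting every edge whose terminal vertex lies in $S$ and every edge whose initial vertex lies in $T$. -/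

import Mathlib

/-!
A directed multigraph with vertex set `V` is a `Quiver` on `V`: for every ordered pair `(a, b)` of
vertices the type `a ⟶ b` of edges from `a` to `b`. Loops and parallel edges are allowed.
-/

namespace DirMultigraph

variable {V : Type*} [Quiver V]

/-- An `X`-path: a non-trivial directed path (without repeated vertices) whose two endvertices lie
in `X` and which contains no other vertex of `X`. A `Quiver.Path` is a directed walk, that is, a
finite sequence of consecutive directed edges. -/
structure XPath (X : Set V) where
  /-- the first vertex -/
  first : V
  /-- the last vertex -/
  last : V
  /-- the underlying directed walk -/
  walk : Quiver.Path first last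
  nodup : walk.vertices.Nodup
  nontrivial : 0 < walk.length
  first_mem : first ∈ X
  last_mem : last ∈ X
  eq_of_mem : ∀ v ∈ walk.vertices, v ∈ X → v = first ∨ v = last

/-- The set of vertices of an `X`-path. -/
def XPath.vertexSet {X : Set V} (P : XPath X) : Set V := {v | v ∈ P.walk.vertices}

/-- The set of edges arriving in `S`. -/
def edgesInto (S : Set V) : WideSubquiver V := fun _ b => {_e | b ∈ S}

/-- The set of edges leaving `T`. -/
def edgesOutOf (T : Set V) : WideSubquiver V := fun a _ => {_e | a ∈ T}

/-- The spanning subgraph obtained by deleting the edges that arrive in `S` and the edges that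
leave `T`. -/
def deleteInOut (S T : Set V) : WideSubquiver V :=
  fun a b => (edgesInto S a b ∪ edgesOutOf T a b)ᶜ

/-- The vertex set of a weak component of a spanning subgraph, as a set of vertices of the whole
graph. -/
def componentVertices {H : WideSubquiver V} (C : Quiver.WeaklyConnectedComponent H) : Set V :=
  {v | Quiver.WeaklyConnectedComponent.mk (V := H) v = C}

end DirMultigraph

/-!
Necessity: an `X`-path that avoids `S ∩ T` contains two vertices of `X ∪ S ∪ T` in one weak
component of `D_{S,T}`, the submultigraph without the edges into `S` and out of `T`.

Sufficiency follows Gallai's reduction to matchings. In the split graph every vertex outside `X` is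
replaced by an out-copy and an in-copy joined by an edge, and every edge `u ⟶ v` of `D` joins the
out-copy of `u` to the in-copy of `v`. Oriented from out-copies to in-copies, the edges of a
matching form a partial injection on `V`; if the matching misses at most `|X| - 2k` vertices, at
least `k` of its orbits run from `X` to `X`. The deficiency version of Tutte's theorem provides such
a matching: for a set `U` of vertices of the split graph let `S` and `T` be the sets of vertices
whose in-copy, respectively out-copy, lies in `U`. Then the components of the split graph minus `U`
are the weak components of `D_{S,T}` other than the singletons in `S ∩ T`, and a component is odd if
and only if the weak component meets `X ∪ S ∪ T` in an odd number of vertices.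
-/

namespace DirMultigraph

section DeficientMatching

variable {W W' : Type*} {G : SimpleGraph W} {G' : SimpleGraph W'}

theorem ncard_eq_ncard_preimage_inl_add_ncard_preimage_inr [Finite W] [Finite W']
    (U : Set (W ⊕ W')) : U.ncard = (Sum.inl ⁻¹' U).ncard + (Sum.inr ⁻¹' U).ncard := by
  conv_lhs => rw [← Set.image_preimage_inl_union_image_preimage_inr U]
  rw [Set.ncard_union_eq Set.disjoint_image_inl_image_inr,
    Set.ncard_image_of_injective _ Sum.inl_injective,
    Set.ncard_image_of_injective _ Sum.inr_injective]

theorem ncard_oddComponents_eq_of_iso (φ : G ≃g G') :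
    G.oddComponents.ncard = G'.oddComponents.ncard := by
  rw [← Set.ncard_image_of_injective _ φ.connectedComponentEquiv.injective,
    Equiv.image_eq_preimage_symm]
  congr 1
  ext C
  simp only [SimpleGraph.oddComponents, Set.mem_preimage, Set.mem_ofPred_eq]
  rw [← Nat.card_coe_set_eq, ← Nat.card_coe_set_eq,
    Nat.card_congr (SimpleGraph.ConnectedComponent.isoEquivSupp φ.symm C)]
  rfl

theorem odd_ncard_oddComponents_add_ncard [Finite W] (G : SimpleGraph W) (U : Set W) :
    Odd ((G.induce Uᶜ).oddComponents.ncard + U.ncard) ↔ Odd (Nat.card W) := by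
  have hodd := SimpleGraph.odd_ncard_oddComponents (G.induce Uᶜ)
  rw [Nat.card_coe_set_eq] at hodd
  rw [← Set.ncard_add_ncard_compl U, Nat.odd_add, Nat.odd_add', hodd]

theorem exists_isPerfectMatching_iff [Finite W] :
    (∃ M : G.Subgraph, M.IsPerfectMatching) ↔
      ∀ U : Set W, (G.induce Uᶜ).oddComponents.ncard ≤ U.ncard := by
  refine SimpleGraph.tutte.trans (forall_congr' fun U => ?_)
  rw [SimpleGraph.IsTutteViolator, not_lt, SimpleGraph.Subgraph.deleteVerts,
    SimpleGraph.Subgraph.verts_top, ← Set.compl_eq_univ_sdiff,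
    ← SimpleGraph.induce_eq_coe_induce_top]
  rfl

/-- The join of `G` with the complete graph on `ι`. -/
def joinTop (G : SimpleGraph W) (ι : Type*) : SimpleGraph (W ⊕ ι) :=
  (G ⊕g ⊤) ⊔ completeBipartiteGraph W ι

theorem joinTop_adj_inl {ι : Type*} {a b : W} :
    (joinTop G ι).Adj (Sum.inl a) (Sum.inl b) ↔ G.Adj a b := by
  simp [joinTop]

theorem joinTop_adj_inr {ι : Type*} {p : W ⊕ ι} {i : ι} :
    (joinTop G ι).Adj p (Sum.inr i) ↔ p ≠ Sum.inr i := by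
  rcases p with a | j <;> simp [joinTop]

/-- Deleting `U` from the join of `G` with a complete graph contained in `U` only leaves vertices
of `G`. -/
noncomputable def induceComplIsoOfRangeInrSubset {ι : Type*} {U : Set (W ⊕ ι)}
    (hU : Set.range Sum.inr ⊆ U) :
    G.induce (Sum.inl ⁻¹' U)ᶜ ≃g (joinTop G ι).induce Uᶜ :=
  RelIso.ofSurjective ⟨⟨fun w => ⟨Sum.inl w.1, w.2⟩,
    fun a b h => by simpa [Subtype.ext_iff] using h⟩, joinTop_adj_inl⟩ <| by
    rintro ⟨a | i, h⟩
    · exact ⟨⟨a, h⟩, rfl⟩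
    · exact absurd (hU ⟨i, rfl⟩) h

theorem preconnected_induce_compl_joinTop {ι : Type*} {U : Set (W ⊕ ι)} {i : ι}
    (hi : Sum.inr i ∉ U) : ((joinTop G ι).induce Uᶜ).Preconnected := by
  have hreach (p : ↥Uᶜ) : ((joinTop G ι).induce Uᶜ).Reachable p ⟨Sum.inr i, hi⟩ := by
    by_cases hp : p = ⟨Sum.inr i, hi⟩
    · rw [hp]
    · exact SimpleGraph.Adj.reachable (joinTop_adj_inr.2 fun h => hp (Subtype.ext h))
  exact fun p q => (hreach p).trans (hreach q).symm

theorem exists_isPerfectMatching_joinTop [Finite W] {ι : Type*} [Finite ι]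
    (heven : Even (Nat.card W + Nat.card ι))
    (h : ∀ U : Set W, (G.induce Uᶜ).oddComponents.ncard ≤ U.ncard + Nat.card ι) :
    ∃ M : (joinTop G ι).Subgraph, M.IsPerfectMatching := by
  refine exists_isPerfectMatching_iff.2 fun U => ?_
  by_cases hU : Set.range Sum.inr ⊆ U
  · rw [← ncard_oddComponents_eq_of_iso (induceComplIsoOfRangeInrSubset hU),
      ncard_eq_ncard_preimage_inl_add_ncard_preimage_inr U,
      Set.preimage_eq_univ_iff.2 hU, Set.ncard_univ]
    exact h _
  · obtain ⟨_, ⟨i, rfl⟩, hi⟩ := Set.not_subset.1 hU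
    have := (preconnected_induce_compl_joinTop (G := G) hi).subsingleton_connectedComponent
    have hle := Set.ncard_le_one_of_subsingleton ((joinTop G ι).induce Uᶜ).oddComponents
    have hpar := odd_ncard_oddComponents_add_ncard (joinTop G ι) U
    rw [Nat.card_sum, ← Nat.not_even_iff_odd, ← Nat.not_even_iff_odd, not_iff_not] at hpar
    have hevenU := hpar.2 heven
    by_contra! hlt
    rw [show U.ncard = 0 by omega, show Set.ncard _ = 1 by omega] at hevenU
    exact absurd hevenU (by decide)

/-- The subgraph of `G` formed by the edges of `M` that lie inside `G`. -/
def restrictInl {ι : Type*} (M : (joinTop G ι).Subgraph) : G.Subgraph where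
  verts := {a | ∃ b, M.Adj (Sum.inl a) (Sum.inl b)}
  Adj a b := M.Adj (Sum.inl a) (Sum.inl b)
  adj_sub h := joinTop_adj_inl.1 h.adj_sub
  edge_vert h := ⟨_, h⟩
  symm.symm _ _ h := h.symm

theorem exists_isMatching_of_even [Finite W] (d : ℕ) (heven : Even (Nat.card W + d))
    (h : ∀ U : Set W, (G.induce Uᶜ).oddComponents.ncard ≤ U.ncard + d) :
    ∃ M : G.Subgraph, M.IsMatching ∧ M.vertsᶜ.ncard ≤ d := by
  obtain ⟨M, hM⟩ := exists_isPerfectMatching_joinTop (G := G) (ι := Fin d) (by simpa) (by simpa)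
  refine ⟨restrictInl M, fun a ⟨b, hab⟩ => ⟨b, hab, fun c hac =>
    Sum.inl_injective (hM.1.eq_of_adj_left hac hab)⟩, ?_⟩
  have hnew (a : ↥(restrictInl M).vertsᶜ) : ∃ i : Fin d, M.Adj (Sum.inl a.1) (Sum.inr i) := by
    obtain ⟨b | i, hab, -⟩ := SimpleGraph.Subgraph.isPerfectMatching_iff.1 hM (Sum.inl a.1)
    · exact absurd ⟨b, hab⟩ a.2
    · exact ⟨i, hab⟩
  choose i hi using hnew
  have hinj : Function.Injective i := fun a b hab =>
    Subtype.ext (Sum.inl_injective (hM.1.eq_of_adj_right (hi a) (hab ▸ hi b)))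
  simpa [Nat.card_coe_set_eq] using Nat.card_le_card_of_injective i hinj

theorem exists_isMatching_of_ncard_oddComponents_le [Finite W] (d : ℕ)
    (h : ∀ U : Set W, (G.induce Uᶜ).oddComponents.ncard ≤ U.ncard + d) :
    ∃ M : G.Subgraph, M.IsMatching ∧ M.vertsᶜ.ncard ≤ d := by
  rcases Nat.even_or_odd (Nat.card W + d) with heven | hodd
  · exact exists_isMatching_of_even d heven h
  have hlt (U : Set W) : (G.induce Uᶜ).oddComponents.ncard < U.ncard + d := by
    refine (h U).lt_of_ne fun heq => ?_
    have hpar := odd_ncard_oddComponents_add_ncard G U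
    rw [heq] at hpar
    grind
  obtain ⟨d, rfl⟩ : ∃ d', d = d' + 1 := Nat.exists_eq_add_one.2 <| by
    simpa using Nat.zero_lt_of_lt (hlt ∅)
  obtain ⟨M, hM, hd⟩ := exists_isMatching_of_even (G := G) d (by grind) fun U => by
    have := hlt U
    omega
  exact ⟨M, hM, hd.trans d.le_succ⟩

end DeficientMatching

section Counting

variable {V ι C : Type*} [Finite V]

theorem ncard_eq_sum_ncard_preimage_inter [Fintype C] (f : V → C) (W : Set V) :
    W.ncard = ∑ c, (f ⁻¹' {c} ∩ W).ncard := by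
  have hdisj : Pairwise (Function.onFun Disjoint fun c => f ⁻¹' {c} ∩ W) := fun c c' hc =>
    ((Set.disjoint_singleton.2 hc).preimage f).mono Set.inter_subset_left Set.inter_subset_left
  rw [← finsum_eq_sum_of_fintype, ← Set.ncard_iUnion_of_finite (fun _ => Set.toFinite _) hdisj,
    ← Set.iUnion_inter, ← Set.preimage_iUnion, Set.iUnion_of_singleton, Set.preimage_univ,
    Set.univ_inter]

theorem two_mul_finsum_half_add_ncard_odd [Finite C] (f : V → C) (W : Set V) :
    2 * ∑ᶠ c, (f ⁻¹' {c} ∩ W).ncard / 2 + {c | Odd (f ⁻¹' {c} ∩ W).ncard}.ncard = W.ncard := by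
  classical
  have := Fintype.ofFinite C
  have hodd : {c | Odd (f ⁻¹' {c} ∩ W).ncard}.ncard = ∑ c, (f ⁻¹' {c} ∩ W).ncard % 2 := by
    rw [Set.ncard_eq_toFinset_card', Set.toFinset_ofPred, Finset.card_filter]
    refine Finset.sum_congr rfl fun c _ => ?_
    split_ifs with hc
    · exact (Nat.odd_iff.1 hc).symm
    · exact (Nat.not_odd_iff.1 hc).symm
  rw [hodd, finsum_eq_sum_of_fintype, Finset.mul_sum, ← Finset.sum_add_distrib,
    ncard_eq_sum_ncard_preimage_inter f W]
  exact Finset.sum_congr rfl fun c _ => Nat.div_add_mod _ 2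

theorem ncard_mul_le_ncard_of_pairwiseDisjoint [Finite ι] {s : Set ι} {A : ι → Set V} {B : Set V}
    {n : ℕ} (hA : s.PairwiseDisjoint A) (hn : ∀ i ∈ s, n ≤ (A i ∩ B).ncard) :
    s.ncard * n ≤ B.ncard := by
  have hdisj : s.PairwiseDisjoint fun i => A i ∩ B :=
    hA.mono fun _ => Set.inter_subset_left
  calc s.ncard * n = ∑ _ ∈ s.toFinite.toFinset, n := by
        rw [Finset.sum_const, smul_eq_mul, Set.ncard_eq_toFinset_card s]
    _ ≤ ∑ i ∈ s.toFinite.toFinset, (A i ∩ B).ncard :=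
        Finset.sum_le_sum fun _ hi => hn _ (s.toFinite.mem_toFinset.1 hi)
    _ = (⋃ i ∈ s, A i ∩ B).ncard := by
        rw [s.toFinite.ncard_biUnion (fun _ _ => Set.toFinite _) hdisj,
          finsum_mem_eq_finite_toFinset_sum _ s.toFinite]
    _ ≤ B.ncard := Set.ncard_le_ncard (Set.iUnion₂_subset fun _ _ => Set.inter_subset_right)

theorem card_le_finsum_half_of_pairwiseDisjoint [Finite C] [Finite ι] {A : ι → Set V} {f : V → C}
    {W : Set V} (hA : Pairwise (Function.onFun Disjoint A))
    (h : ∀ i, ∃ c, (A i ∩ (f ⁻¹' {c} ∩ W)).Nontrivial) :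
    Nat.card ι ≤ ∑ᶠ c, (f ⁻¹' {c} ∩ W).ncard / 2 := by
  have := Fintype.ofFinite C
  choose g hg using h
  rw [finsum_eq_sum_of_fintype, ← Set.ncard_univ, ncard_eq_sum_ncard_preimage_inter g]
  refine Finset.sum_le_sum fun c _ => (Nat.le_div_iff_mul_le two_pos).2 ?_
  rw [Set.inter_univ]
  refine ncard_mul_le_ncard_of_pairwiseDisjoint (hA.set_pairwise _) fun i hi => ?_
  exact Set.one_lt_ncard_iff_nontrivial.2 (hi ▸ hg i)

theorem card_le_of_pairwiseDisjoint [Finite C] [Finite ι] {A : ι → Set V} {f : V → C}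
    {Z W : Set V} (hA : Pairwise (Function.onFun Disjoint A))
    (h : ∀ i, (A i ∩ Z).Nonempty ∨ ∃ c, (A i ∩ (f ⁻¹' {c} ∩ W)).Nontrivial) :
    Nat.card ι ≤ Z.ncard + ∑ᶠ c, (f ⁻¹' {c} ∩ W).ncard / 2 := by
  set s : Set ι := {i | (A i ∩ Z).Nonempty}
  have hmeet : s.ncard * 1 ≤ Z.ncard :=
    ncard_mul_le_ncard_of_pairwiseDisjoint (hA.set_pairwise _) fun i hi => (Set.ncard_pos).2 hi
  have hpair : sᶜ.ncard ≤ ∑ᶠ c, (f ⁻¹' {c} ∩ W).ncard / 2 := by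
    rw [← Nat.card_coe_set_eq]
    exact card_le_finsum_half_of_pairwiseDisjoint (A := fun i : ↥sᶜ => A i)
      (hA.comp_of_injective Subtype.val_injective) fun i => (h i).resolve_left i.2
  rw [← s.ncard_add_ncard_compl]
  omega

end Counting

section Components

variable {V : Type*} [Quiver V] {S T W X : Set V} {a b u v : V}

/-- The weak component of a vertex after deleting the edges into `S` and the edges out of `T`. -/
def componentOf (S T : Set V) (v : V) : Quiver.WeaklyConnectedComponent (deleteInOut S T) :=
  Quiver.WeaklyConnectedComponent.mk (V := deleteInOut S T) v

theorem componentOf_surjective (S T : Set V) : Function.Surjective (componentOf S T) :=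
  Quotient.mk_surjective

instance [Finite V] (S T : Set V) : Finite (Quiver.WeaklyConnectedComponent (deleteInOut S T)) :=
  Finite.of_surjective _ (componentOf_surjective S T)

theorem componentOf_eq_of_hom (e : u ⟶ v) (hv : v ∉ S) (hu : u ∉ T) :
    componentOf S T u = componentOf S T v :=
  (Quiver.WeaklyConnectedComponent.eq (V := deleteInOut S T) u v).2
    ⟨Quiver.Path.nil.cons (Sum.inl ⟨e, fun h => h.elim hv hu⟩)⟩

theorem componentOf_induction {p : V → Prop} (h : componentOf S T a = componentOf S T b)
    (hp : ∀ u v, Nonempty (u ⟶ v) → v ∉ S → u ∉ T → (p u ↔ p v)) : p a ↔ p b := by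
  have hstep (u v : V) (e : Quiver.Hom (V := deleteInOut S T) u v) : p u ↔ p v :=
    hp u v ⟨e.1⟩ (fun hv => e.2 (Or.inl hv)) (fun hu => e.2 (Or.inr hu))
  obtain ⟨q⟩ := (Quiver.WeaklyConnectedComponent.eq (V := deleteInOut S T) a b).1 h
  clear h
  induction q with
  | nil => rfl
  | cons _ e ih =>
    rcases e with e | e
    · exact ih.trans (hstep _ _ e)
    · exact ih.trans (hstep _ _ e).symm

theorem eq_of_componentOf_eq_of_mem_inter (hu : u ∈ S ∩ T)
    (h : componentOf S T u = componentOf S T v) : v = u := by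
  refine (componentOf_induction (p := fun w => w = u) h fun a b _ hb ha => ?_).1 rfl
  exact iff_of_false (fun hau => ha (hau ▸ hu.2)) (fun hbu => hb (hbu ▸ hu.1))

theorem exists_nontrivial_or_exists_componentOf_eq (hS : S ⊆ W) (hT : T ⊆ W)
    (p : Quiver.Path a b) (hp : p.vertices.Nodup) (hST : ∀ v ∈ p.vertices, v ∉ S ∩ T)
    (ha : a ∈ W) (haT : a ∉ T) :
    (∃ C, ({v | v ∈ p.vertices} ∩ (componentOf S T ⁻¹' {C} ∩ W)).Nontrivial) ∨
      b ∉ T ∧ ∃ x ∈ p.vertices, x ∈ W ∧ componentOf S T x = componentOf S T b := by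
  induction p with
  | nil => exact Or.inr ⟨haT, a, by simp, ha, rfl⟩
  | @cons b c p e ih =>
    simp only [Quiver.Path.vertices_cons, List.concat_eq_append, List.nodup_append,
      List.mem_append, List.mem_singleton] at hp hST ⊢
    rcases ih hp.1 fun v hv => hST v (Or.inl hv) with ⟨C, hC⟩ | ⟨hbT, x, hx, hxW, hxb⟩
    · exact Or.inl ⟨C, hC.mono (Set.inter_subset_inter_left _ fun v hv => Or.inl hv)⟩
    by_cases hcS : c ∈ S
    · exact Or.inr ⟨fun hcT => hST c (Or.inr rfl) ⟨hcS, hcT⟩, c, Or.inr rfl, hS hcS, rfl⟩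
    have hxc : componentOf S T x = componentOf S T c := hxb.trans (componentOf_eq_of_hom e hcS hbT)
    by_cases hcW : c ∈ W
    · exact Or.inl ⟨componentOf S T c, x, ⟨Or.inl hx, hxc, hxW⟩, c, ⟨Or.inr rfl, rfl, hcW⟩,
        hp.2.2 x hx c rfl⟩
    · exact Or.inr ⟨fun hcT => hcW (hT hcT), x, Or.inl hx, hxW, hxc⟩

theorem XPath.inter_nonempty_or_exists_nontrivial (hX : X ∩ S = X ∩ T) (P : XPath X) :
    (P.vertexSet ∩ (S ∩ T)).Nonempty ∨
      ∃ C, (P.vertexSet ∩ (componentOf S T ⁻¹' {C} ∩ (X ∪ S ∪ T))).Nontrivial := by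
  obtain ⟨a, b, p, hp, hpos, ha, hb, -⟩ := P
  rw [or_iff_not_imp_left, Set.not_nonempty_iff_eq_empty, ← Set.disjoint_iff_inter_eq_empty,
    Set.disjoint_left]
  intro hST
  have hXS {v : V} (hv : v ∈ p.vertices) (hvX : v ∈ X) : v ∉ S ∧ v ∉ T := by
    have hiff : v ∈ S ↔ v ∈ T := by simpa [hvX] using Set.ext_iff.1 hX v
    exact ⟨fun h => hST hv ⟨h, hiff.1 h⟩, fun h => hST hv ⟨hiff.2 h, h⟩⟩
  cases p with
  | nil => simp at hpos
  | @cons c _ p e =>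
    have hsub : {v | v ∈ p.vertices} ⊆ {v | v ∈ (p.cons e).vertices} := fun v hv => by
      simp [show v ∈ p.vertices from hv]
    have hbP : b ∈ (p.cons e).vertices := by simp
    rw [Quiver.Path.vertices_cons, List.concat_eq_append, List.nodup_append] at hp
    rcases exists_nontrivial_or_exists_componentOf_eq (S := S) (T := T) (W := X ∪ S ∪ T)
        (by grind) (by grind) p hp.1 (fun v hv => hST (hsub hv)) (Or.inl (Or.inl ha))
        (hXS (hsub p.start_mem_vertices) ha).2 with ⟨C, hC⟩ | ⟨hcT, x, hx, hxW, hxc⟩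
    · exact ⟨C, hC.mono (Set.inter_subset_inter_left _ hsub)⟩
    · exact ⟨componentOf S T b,
        x, ⟨hsub hx, hxc.trans (componentOf_eq_of_hom e (hXS hbP hb).1 hcT), hxW⟩,
        b, ⟨hbP, rfl, Or.inl (Or.inl hb)⟩, hp.2.2 x hx b (by simp)⟩

end Components

section PartialInjection

open Relation

variable {V : Type*} {F : V → V → Prop} {X : Set V} {a b s t v : V}

theorem eq_of_reflTransGen_of_forall_not_right (hr : Relator.RightUnique F)
    (hs : ∀ w, ¬F s w) (ht : ∀ w, ¬F t w) (has : ReflTransGen F a s) (hat : ReflTransGen F a t) :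
    s = t := by
  have heq {s t : V} (hs : ∀ w, ¬F s w) (h : ReflTransGen F s t) : s = t :=
    h.cases_head.resolve_right fun ⟨w, hw, _⟩ => hs w hw
  exact (has.total_of_right_unique hr hat).elim (heq hs) fun h => (heq ht h).symm

theorem eq_of_reflTransGen_of_forall_not_left (hl : Relator.LeftUnique F)
    (ha : ∀ u, ¬F u a) (hb : ∀ u, ¬F u b) (hav : ReflTransGen F a v) (hbv : ReflTransGen F b v) :
    a = b :=
  eq_of_reflTransGen_of_forall_not_right (F := Function.swap F) (fun _ _ _ h h' => hl h h') ha hb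
    hav.swap hbv.swap

theorem exists_reflTransGen_forall_not [Finite V] (hl : Relator.LeftUnique F)
    (ha : ∀ u, ¬F u a) : ∃ t, ReflTransGen F a t ∧ ∀ w, ¬F t w := by
  -- Otherwise the successor map on the orbit of `a` is injective but misses `a`.
  by_contra! h
  choose next hnext using h
  let g : {t // ReflTransGen F a t} → {t // ReflTransGen F a t} :=
    fun t => ⟨next t.1 t.2, t.2.tail (hnext t.1 t.2)⟩
  have hF (t : {t // ReflTransGen F a t}) : F t (g t) := hnext t.1 t.2
  have hg : Function.Injective g := fun s t hst => Subtype.ext (hl (hF s) (hst ▸ hF t))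
  obtain ⟨t, ht⟩ := Finite.injective_iff_surjective.1 hg ⟨a, .refl⟩
  exact ha t ((congrArg (fun s => F t s.1) ht).mp (hF t))

theorem le_ncard_setOf_transGen [Finite V] (hl : Relator.LeftUnique F)
    (hX : ∀ x ∈ X, ∀ u v, F u x → ¬F x v) {k : ℕ} (hk : Xᶜ.ncard + k ≤ {v | ∃ w, F v w}.ncard) :
    k ≤ {a ∈ X | ∃ t ∈ X, TransGen F a t}.ncard := by
  set D : Set V := {v | ∃ w, F v w}
  set A : Set V := {a ∈ X | ∃ t ∈ X, TransGen F a t}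
  have hpred (a : ↥((D ∩ X) \ A)) (u : V) : ¬F u a := fun h =>
    have ⟨⟨⟨w, hw⟩, haX⟩, _⟩ := a.2
    hX a haX u w h hw
  choose t hat ht using fun a => exists_reflTransGen_forall_not hl (hpred a)
  have htX (a : ↥((D ∩ X) \ A)) : t a ∈ Xᶜ \ D := by
    refine ⟨fun htX => ?_, fun ⟨w, hw⟩ => ht a w hw⟩
    obtain ⟨⟨⟨w, hw⟩, haX⟩, haA⟩ := a.2
    rcases reflTransGen_iff_eq_or_transGen.1 (hat a) with h | h
    · exact ht a w (h ▸ hw)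
    · exact haA ⟨haX, t a, htX, h⟩
  have ht_inj : Function.Injective t := fun a b hab => Subtype.ext <|
    eq_of_reflTransGen_of_forall_not_left hl (hpred a) (hpred b) (hat a) (hab ▸ hat b)
  have hbad : ((D ∩ X) \ A).ncard ≤ (Xᶜ \ D).ncard := by
    simpa only [Nat.card_coe_set_eq] using
      Nat.card_le_card_of_injective (fun a => (⟨t a, htX a⟩ : ↥(Xᶜ \ D)))
        fun a b hab => ht_inj (congrArg Subtype.val hab)
  have hD := Set.ncard_inter_add_ncard_sdiff_eq_ncard D X
  rw [Set.sdiff_eq, Set.inter_comm D Xᶜ] at hD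
  have hXc := Set.ncard_inter_add_ncard_sdiff_eq_ncard Xᶜ D
  have hsplit := Set.le_ncard_sdiff A (D ∩ X)
  omega

theorem ncard_setOf_exists_left_le [Finite V] (hr : Relator.RightUnique F) :
    {v | ∃ u, F u v}.ncard ≤ {u | ∃ v, F u v}.ncard := by
  choose g hg using fun v : {v | ∃ u, F u v} => v.2
  have hinj : Function.Injective g := fun v w h => Subtype.ext (hr (hg v) (h ▸ hg w))
  simpa only [Nat.card_coe_set_eq] using Nat.card_le_card_of_injective
    (fun v => (⟨g v, v, hg v⟩ : {u | ∃ v, F u v})) fun v w h => hinj (congrArg Subtype.val h)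

variable [Quiver V]

theorem exists_nodup_path_of_reflTransGen (hF : ∀ u v, F u v → Nonempty (u ⟶ v) ∨ u = v)
    (h : ReflTransGen F a b) :
    ∃ p : Quiver.Path a b, p.vertices.Nodup ∧ ∀ v ∈ p.vertices, ReflTransGen F a v := by
  induction h with
  | refl => exact ⟨.nil, by simp, by simpa using ReflTransGen.refl⟩
  | @tail b c hab hbc ih =>
    obtain ⟨p, hn, hp⟩ := ih
    by_cases hc : c ∈ p.vertices
    · obtain ⟨q, r, rfl⟩ := p.exists_eq_comp_of_mem_vertices hc
      have hsub : q.vertices.Sublist (q.comp r).vertices := by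
        rw [Quiver.Path.vertices_comp]
        simpa only [q.dropLast_append_end_eq] using
          (List.Sublist.refl q.vertices.dropLast).append
            (List.singleton_sublist.2 r.start_mem_vertices)
      exact ⟨q, hn.sublist hsub, fun v hv => hp v (hsub.subset hv)⟩
    · obtain ⟨e⟩ := (hF b c hbc).resolve_right fun h => hc (h ▸ p.end_mem_vertices)
      refine ⟨p.cons e, ?_, fun v hv => ?_⟩
      · rw [Quiver.Path.vertices_cons, List.nodup_concat]
        exact ⟨hc, hn⟩
      · rcases (Quiver.Path.mem_vertices_cons p e).1 hv with hv | rfl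
        · exact hp v hv
        · exact hab.tail hbc

theorem exists_xPath_of_transGen (hr : Relator.RightUnique F)
    (hF : ∀ u v, F u v → Nonempty (u ⟶ v) ∨ u = v) (hX : ∀ x ∈ X, ∀ u v, F u x → ¬F x v)
    (ha : a ∈ X) (ht : t ∈ X) (hat : TransGen F a t) :
    ∃ P : XPath X, ∀ v ∈ P.vertexSet, ReflTransGen F a v := by
  have hend {x : V} (hx : x ∈ X) (hax : TransGen F a x) (w : V) : ¬F x w :=
    have ⟨u, _, hu⟩ := TransGen.tail'_iff.1 hax
    hX x hx u w hu
  obtain ⟨p, hn, hp⟩ := exists_nodup_path_of_reflTransGen hF hat.to_reflTransGen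
  refine ⟨⟨a, t, p, hn, Nat.pos_of_ne_zero fun h0 => ?_, ha, ht, fun v hv hvX => ?_⟩, hp⟩
  · obtain ⟨w, hw, -⟩ := TransGen.head'_iff.1 hat
    exact hend ht hat w (p.eq_of_length_zero h0 ▸ hw)
  · refine (reflTransGen_iff_eq_or_transGen.1 (hp v hv)).imp_right fun hav => ?_
    exact eq_of_reflTransGen_of_forall_not_right hr (hend hvX hav) (hend ht hat)
      hav.to_reflTransGen hat.to_reflTransGen

/-- `F` is a partial injection that maps each vertex to itself or along an edge, and no vertex of
`X` has both an image and a preimage. The orbits that start and end in `X` yield disjoint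
`X`-paths. -/
structure IsLinkage (X : Set V) (F : V → V → Prop) : Prop where
  rightUnique : Relator.RightUnique F
  leftUnique : Relator.LeftUnique F
  hom_or_eq : ∀ u v, F u v → Nonempty (u ⟶ v) ∨ u = v
  not_right_of_left : ∀ x ∈ X, ∀ u v, F u x → ¬F x v

theorem IsLinkage.exists_disjoint_xPaths [Finite V] (hF : IsLinkage X F) {k : ℕ}
    (hk : Xᶜ.ncard + k ≤ {v | ∃ w, F v w}.ncard) :
    ∃ P : Fin k → XPath X, Pairwise fun i j => Disjoint (P i).vertexSet (P j).vertexSet := by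
  classical
  have := Fintype.ofFinite V
  set A : Set V := {a ∈ X | ∃ t ∈ X, TransGen F a t}
  have hA : k ≤ A.ncard := le_ncard_setOf_transGen hF.leftUnique hF.not_right_of_left hk
  obtain ⟨start⟩ : Nonempty (Fin k ↪ A) := Function.Embedding.nonempty_of_card_le <| by
    rwa [Fintype.card_fin, ← Nat.card_eq_fintype_card, Nat.card_coe_set_eq]
  have hpath (a : A) : ∃ P : XPath X, ∀ v ∈ P.vertexSet, ReflTransGen F a v :=
    have ⟨haX, _, htX, hat⟩ := a.2
    exists_xPath_of_transGen hF.rightUnique hF.hom_or_eq hF.not_right_of_left haX htX hat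
  have hpred (a : A) (u : V) : ¬F u a := fun h =>
    have ⟨haX, _, _, hat⟩ := a.2
    have ⟨w, hw, _⟩ := TransGen.head'_iff.1 hat
    hF.not_right_of_left a haX u w h hw
  choose P hP using hpath
  refine ⟨fun i => P (start i), fun i j hij => Set.disjoint_left.2 fun v hi hj => hij ?_⟩
  exact start.injective <| Subtype.ext <|
    eq_of_reflTransGen_of_forall_not_left hF.leftUnique (hpred _) (hpred _) (hP _ v hi) (hP _ v hj)

end PartialInjection

section SplitGraph

variable {V : Type*} {X : Set V} {v : V}

/-- The vertices of the split graph. Every vertex outside `X` is split into an out-copy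
`Sum.inl v` and an in-copy `Sum.inr v`; a vertex of `X` is its own out-copy and in-copy. -/
abbrev SplitVertex (X : Set V) : Type _ := V ⊕ ↥Xᶜ

/-- The copy of a vertex that carries its outgoing edges. -/
def outCopy (X : Set V) (v : V) : SplitVertex X := Sum.inl v

open Classical in
/-- The copy of a vertex that carries its incoming edges. -/
noncomputable def inCopy (X : Set V) (v : V) : SplitVertex X :=
  if h : v ∈ X then Sum.inl v else Sum.inr ⟨v, h⟩

/-- The vertex of which a vertex of the split graph is a copy. -/
def SplitVertex.base : SplitVertex X → V := Sum.elim id Subtype.val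

theorem outCopy_injective : Function.Injective (outCopy X) := Sum.inl_injective

theorem inCopy_of_mem (hv : v ∈ X) : inCopy X v = outCopy X v := dif_pos hv

theorem inCopy_of_notMem (hv : v ∉ X) : inCopy X v = Sum.inr ⟨v, hv⟩ := dif_neg hv

theorem base_outCopy (v : V) : (outCopy X v).base = v := rfl

theorem base_inCopy (v : V) : (inCopy X v).base = v := by
  by_cases hv : v ∈ X
  · rw [inCopy_of_mem hv, base_outCopy]
  · rw [inCopy_of_notMem hv]
    rfl

theorem inCopy_injective : Function.Injective (inCopy X) :=
  Function.LeftInverse.injective base_inCopy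

theorem eq_outCopy_or_eq_inCopy (p : SplitVertex X) :
    p = outCopy X p.base ∨ p = inCopy X p.base := by
  rcases p with v | v
  · exact Or.inl rfl
  · exact Or.inr (inCopy_of_notMem v.2).symm

theorem ncard_eq_ncard_outCopy_add_ncard_inCopy [Finite V] (U : Set (SplitVertex X)) :
    U.ncard = (outCopy X ⁻¹' U).ncard + (inCopy X ⁻¹' U \ X).ncard := by
  have himage : Subtype.val '' (Sum.inr ⁻¹' U : Set ↥Xᶜ) = inCopy X ⁻¹' U \ X := by
    ext v
    constructor
    · rintro ⟨⟨w, hw⟩, hU, rfl⟩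
      exact ⟨by rwa [Set.mem_preimage, inCopy_of_notMem hw], hw⟩
    · rintro ⟨hU, hv⟩
      exact ⟨⟨v, hv⟩, by rwa [Set.mem_preimage, inCopy_of_notMem hv] at hU, rfl⟩
  rw [ncard_eq_ncard_preimage_inl_add_ncard_preimage_inr U, ← himage,
    Set.ncard_image_of_injective _ Subtype.val_injective]
  rfl

variable [Quiver V]

/-- The graph in which every edge `u ⟶ v` joins the out-copy of `u` to the in-copy of `v`, and the
two copies of a vertex outside `X` are adjacent. -/
def splitGraph (X : Set V) : SimpleGraph (SplitVertex X) :=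
  SimpleGraph.fromEdgeSet
    {e | ∃ u v, (Nonempty (u ⟶ v) ∨ u = v) ∧ e = s(outCopy X u, inCopy X v)}

theorem exists_isLinkage_of_isMatching {M : (splitGraph X).Subgraph} (hM : M.IsMatching) :
    ∃ F : V → V → Prop, IsLinkage X F ∧
      M.verts ⊆ outCopy X '' {u | ∃ v, F u v} ∪ inCopy X '' {v | ∃ u, F u v} := by
  have horient (e : M.edgeSet) : ∃ d : V × V, (Nonempty (d.1 ⟶ d.2) ∨ d.1 = d.2) ∧
      e.1 = s(outCopy X d.1, inCopy X d.2) := by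
    have he : e.1 ∈ (splitGraph X).edgeSet := M.edgeSet_subset e.2
    obtain ⟨⟨u, v, huv, he⟩, -⟩ := (SimpleGraph.edgeSet_fromEdgeSet _).subset he
    exact ⟨(u, v), huv, he⟩
  choose g hlink hg using horient
  have hadj {u v : V} : (∃ e, g e = (u, v)) → M.Adj (outCopy X u) (inCopy X v) := by
    rintro ⟨e, he⟩
    rw [← SimpleGraph.Subgraph.mem_edgeSet]
    simpa only [hg e, he] using e.2
  refine ⟨fun u v => ∃ e, g e = (u, v), ⟨fun u v w hv hw => ?_, fun u w v hu hw => ?_,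
    fun u v ⟨e, he⟩ => by simpa only [he] using hlink e, fun x hx u v hu hv => ?_⟩, fun p hp => ?_⟩
  · exact inCopy_injective (hM.eq_of_adj_left (hadj hv) (hadj hw))
  · exact outCopy_injective (hM.eq_of_adj_right (hadj hu) (hadj hw))
  · have hux := hadj hu
    have hvx := (hadj hv).symm
    rw [← inCopy_of_mem hx] at hvx
    have huv : outCopy X u = inCopy X v := hM.eq_of_adj_right hux hvx
    obtain rfl : u = v := by
      simpa only [base_outCopy, base_inCopy] using congrArg SplitVertex.base huv
    obtain ⟨e, he⟩ := hu
    obtain ⟨e', he'⟩ := hv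
    have hee' : e = e' := Subtype.ext <| by
      rw [hg e, hg e', he, he', huv, ← inCopy_of_mem hx, Sym2.eq_swap]
    obtain rfl : u = x := congrArg Prod.fst (he.symm.trans (hee' ▸ he'))
    exact hux.ne huv
  · obtain ⟨q, hpq, -⟩ := hM hp
    have hpqe := hg ⟨s(p, q), hpq⟩
    generalize hd : g ⟨s(p, q), hpq⟩ = d at hpqe
    rcases Sym2.eq_iff.1 hpqe with ⟨rfl, -⟩ | ⟨rfl, -⟩
    · exact Or.inl ⟨d.1, ⟨d.2, _, hd⟩, rfl⟩
    · exact Or.inr ⟨d.2, ⟨d.1, _, hd⟩, rfl⟩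

theorem exists_disjoint_xPaths_of_isMatching [Finite V] {M : (splitGraph X).Subgraph}
    (hM : M.IsMatching) {k : ℕ} (hk : M.vertsᶜ.ncard + 2 * k ≤ X.ncard) :
    ∃ P : Fin k → XPath X, Pairwise fun i j => Disjoint (P i).vertexSet (P j).vertexSet := by
  obtain ⟨F, hF, hverts⟩ := exists_isLinkage_of_isMatching hM
  have hle : M.verts.ncard ≤ {u | ∃ v, F u v}.ncard + {v | ∃ u, F u v}.ncard := by
    refine (Set.ncard_le_ncard hverts).trans ((Set.ncard_union_le _ _).trans_eq ?_)
    rw [Set.ncard_image_of_injective _ outCopy_injective,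
      Set.ncard_image_of_injective _ inCopy_injective]
  have hran := ncard_setOf_exists_left_le hF.rightUnique
  have hcard := M.verts.ncard_add_ncard_compl
  have hV := X.ncard_add_ncard_compl
  rw [Nat.card_sum, Nat.card_coe_set_eq] at hcard
  exact hF.exists_disjoint_xPaths (by omega)

end SplitGraph

section Tutte

variable {V : Type*} {X S T : Set V}

theorem union_inter_eq_inter (hX : X ∩ S = X ∩ T) : (X ∪ S) ∩ T = S ∩ T := by
  rw [Set.union_inter_distrib_right, Set.union_eq_right, ← hX]
  exact Set.subset_inter Set.inter_subset_right (hX.trans_subset Set.inter_subset_right)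

theorem ncard_inter_add_ncard_union [Finite V] (hX : X ∩ S = X ∩ T) :
    (S ∩ T).ncard + (X ∪ S ∪ T).ncard = T.ncard + (S \ X).ncard + X.ncard := by
  rw [← union_inter_eq_inter hX, add_comm, Set.ncard_union_add_ncard_inter, ← Set.union_sdiff_self,
    Set.ncard_union_eq Set.disjoint_sdiff_right]
  ring

theorem ncard_sdiff_add_ncard_sdiff_add_ncard_inter [Finite V] {A : Set V} (hX : X ∩ S = X ∩ T)
    (hA : Disjoint A (S ∩ T)) :
    (A \ T).ncard + (A \ (X ∪ S)).ncard + (A ∩ (X ∪ S ∪ T)).ncard = 2 * A.ncard := by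
  have hdisj : Disjoint (A ∩ (X ∪ S)) (A ∩ T) := by
    rw [Set.disjoint_iff_inter_eq_empty, ← Set.inter_inter_distrib_left, union_inter_eq_inter hX,
      hA.inter_eq]
  rw [Set.inter_union_distrib_left, Set.ncard_union_eq hdisj,
    ← Set.ncard_inter_add_ncard_sdiff_eq_ncard A (X ∪ S)]
  have := Set.ncard_inter_add_ncard_sdiff_eq_ncard A T
  have := Set.ncard_inter_add_ncard_sdiff_eq_ncard A (X ∪ S)
  omega

theorem inter_preimage_inCopy (U : Set (SplitVertex X)) :
    X ∩ inCopy X ⁻¹' U = X ∩ outCopy X ⁻¹' U := by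
  ext v
  exact and_congr_right fun hv => by rw [Set.mem_preimage, inCopy_of_mem hv, Set.mem_preimage]

theorem base_notMem_inter_of_notMem {U : Set (SplitVertex X)} {p : SplitVertex X} (hp : p ∉ U) :
    p.base ∉ inCopy X ⁻¹' U ∩ outCopy X ⁻¹' U := fun ⟨hS, hT⟩ =>
  (eq_outCopy_or_eq_inCopy p).elim (fun h => hp (h ▸ hT)) fun h => hp (h ▸ hS)

variable [Quiver V] {U : Set (SplitVertex X)}

theorem splitGraph_induce_reachable {p q : ↥Uᶜ}
    (hp : p.1 = outCopy X p.1.base) (hq : q.1 = inCopy X q.1.base)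
    (h : Nonempty (p.1.base ⟶ q.1.base) ∨ p.1.base = q.1.base) :
    ((splitGraph X).induce Uᶜ).Reachable p q := by
  by_cases hpq : p = q
  · rw [hpq]
  · exact SimpleGraph.Adj.reachable ⟨⟨_, _, h, by rw [← hp, ← hq]; rfl⟩, Subtype.coe_ne_coe.2 hpq⟩

theorem splitGraph_induce_reachable_of_base_eq {p q : ↥Uᶜ} (h : p.1.base = q.1.base) :
    ((splitGraph X).induce Uᶜ).Reachable p q := by
  rcases eq_outCopy_or_eq_inCopy p.1 with hp | hp <;>
    rcases eq_outCopy_or_eq_inCopy q.1 with hq | hq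
  · rw [Subtype.ext (hp.trans (h ▸ hq.symm))]
  · exact splitGraph_induce_reachable hp hq (Or.inr h)
  · exact (splitGraph_induce_reachable hq hp (Or.inr h.symm)).symm
  · rw [Subtype.ext (hp.trans (h ▸ hq.symm))]

/-- The weak component of `D_{S,T}` in which the component of a vertex of the split graph minus `U`
lies. Here `S` and `T` consist of the vertices whose in-copy, respectively out-copy, is in `U`. -/
def splitComponent (U : Set (SplitVertex X)) (p : SplitVertex X) :
    Quiver.WeaklyConnectedComponent (deleteInOut (inCopy X ⁻¹' U) (outCopy X ⁻¹' U)) :=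
  componentOf _ _ p.base

theorem splitComponent_eq_of_adj {p q : ↥Uᶜ} (h : (splitGraph X).Adj p q) :
    splitComponent U p = splitComponent U q := by
  have hlink {u v : V} (huv : Nonempty (u ⟶ v) ∨ u = v) (hu : outCopy X u ∉ U)
      (hv : inCopy X v ∉ U) :
      splitComponent U (outCopy X u) = splitComponent U (inCopy X v) := by
    rw [splitComponent, splitComponent, base_outCopy, base_inCopy]
    rcases huv with ⟨⟨e⟩⟩ | rfl
    · exact componentOf_eq_of_hom e hv hu
    · rfl
  obtain ⟨p, hp⟩ := p
  obtain ⟨q, hq⟩ := q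
  obtain ⟨⟨u, v, huv, he⟩, -⟩ := h
  rcases Sym2.eq_iff.1 he with ⟨rfl, rfl⟩ | ⟨rfl, rfl⟩
  · exact hlink huv hp hq
  · exact (hlink huv hq hp).symm

theorem splitGraph_induce_reachable_iff {p q : ↥Uᶜ} :
    ((splitGraph X).induce Uᶜ).Reachable p q ↔ splitComponent U p = splitComponent U q := by
  constructor
  · rintro ⟨w⟩
    induction w with
    | nil => rfl
    | cons h _ ih => exact (splitComponent_eq_of_adj h).trans ih
  · intro h
    refine (componentOf_induction (p := fun v => ∀ r : ↥Uᶜ, r.1.base = v →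
      ((splitGraph X).induce Uᶜ).Reachable p r) h fun u v huv hv hu => ?_).1
      (fun r hr => splitGraph_induce_reachable_of_base_eq hr.symm) q rfl
    let u' : ↥Uᶜ := ⟨outCopy X u, hu⟩
    let v' : ↥Uᶜ := ⟨inCopy X v, hv⟩
    have hv' : v'.1.base = v := base_inCopy v
    have huv' : ((splitGraph X).induce Uᶜ).Reachable u' v' :=
      splitGraph_induce_reachable rfl (by rw [hv']) (Or.inl (by rwa [hv']))
    constructor
    · intro ih r hr
      exact ((ih u' rfl).trans huv').trans
        (splitGraph_induce_reachable_of_base_eq (hv'.trans hr.symm))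
    · intro ih r hr
      exact ((ih v' hv').trans huv'.symm).trans (splitGraph_induce_reachable_of_base_eq hr.symm)

theorem splitComponent_ne_componentOf (p : ↥Uᶜ) {v : V}
    (hv : v ∈ inCopy X ⁻¹' U ∩ outCopy X ⁻¹' U) : splitComponent U p ≠ componentOf _ _ v :=
  fun h => base_notMem_inter_of_notMem p.2 <|
    (eq_of_componentOf_eq_of_mem_inter hv h.symm).symm ▸ hv

theorem odd_ncard_supp_iff [Finite V] (p : ↥Uᶜ) :
    Odd (((splitGraph X).induce Uᶜ).connectedComponentMk p).supp.ncard ↔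
      Odd (componentVertices (splitComponent U p) ∩
        (X ∪ inCopy X ⁻¹' U ∪ outCopy X ⁻¹' U)).ncard := by
  set A := componentVertices (splitComponent U p)
  have himage : Subtype.val '' (((splitGraph X).induce Uᶜ).connectedComponentMk p).supp =
      {q | q ∉ U ∧ q.base ∈ A} := by
    ext q
    constructor
    · rintro ⟨q, hq, rfl⟩
      exact ⟨q.2, splitGraph_induce_reachable_iff.1 (SimpleGraph.ConnectedComponent.eq.1 hq)⟩
    · rintro ⟨hqU, hq⟩
      exact ⟨⟨q, hqU⟩, SimpleGraph.ConnectedComponent.eq.2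
        (splitGraph_induce_reachable_iff.2 hq), rfl⟩
  have hout : outCopy X ⁻¹' {q | q ∉ U ∧ q.base ∈ A} = A \ outCopy X ⁻¹' U := by
    ext v
    exact and_comm
  have hin : inCopy X ⁻¹' {q | q ∉ U ∧ q.base ∈ A} \ X = A \ (X ∪ inCopy X ⁻¹' U) := by
    ext v
    simp only [Set.mem_sdiff, Set.mem_preimage, Set.mem_ofPred_eq, base_inCopy, Set.mem_union]
    tauto
  have hA : Disjoint A (inCopy X ⁻¹' U ∩ outCopy X ⁻¹' U) :=
    Set.disjoint_left.2 fun v hvA hv => splitComponent_ne_componentOf p hv hvA.symm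
  have hcard := ncard_sdiff_add_ncard_sdiff_add_ncard_inter (inter_preimage_inCopy U) hA
  rw [← Set.ncard_image_of_injective _ Subtype.val_injective, himage,
    ncard_eq_ncard_outCopy_add_ncard_inCopy, hout, hin]
  grind

theorem ncard_oddComponents_add_ncard_inter_le [Finite V] :
    ((splitGraph X).induce Uᶜ).oddComponents.ncard + (inCopy X ⁻¹' U ∩ outCopy X ⁻¹' U).ncard ≤
      {C : Quiver.WeaklyConnectedComponent (deleteInOut (inCopy X ⁻¹' U) (outCopy X ⁻¹' U)) |
        Odd (componentVertices C ∩ (X ∪ inCopy X ⁻¹' U ∪ outCopy X ⁻¹' U)).ncard}.ncard := by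
  let φ : ((splitGraph X).induce Uᶜ).ConnectedComponent →
      Quiver.WeaklyConnectedComponent (deleteInOut (inCopy X ⁻¹' U) (outCopy X ⁻¹' U)) :=
    SimpleGraph.ConnectedComponent.lift (fun p => splitComponent U p)
      fun _ _ w _ => splitGraph_induce_reachable_iff.1 w.reachable
  have hφ : Function.Injective φ := fun c d => c.ind₂ (fun p q h =>
    SimpleGraph.ConnectedComponent.eq.2 (splitGraph_induce_reachable_iff.2 h)) d
  have hcomp : Set.InjOn (componentOf (inCopy X ⁻¹' U) (outCopy X ⁻¹' U))
      (inCopy X ⁻¹' U ∩ outCopy X ⁻¹' U) := fun u hu v _ h =>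
    (eq_of_componentOf_eq_of_mem_inter hu h).symm
  rw [← Set.ncard_image_of_injective _ hφ, ← hcomp.ncard_image, ← Set.ncard_union_eq]
  · refine Set.ncard_le_ncard (Set.union_subset ?_ ?_)
    · rintro _ ⟨c, hc, rfl⟩
      induction c using SimpleGraph.ConnectedComponent.ind with | _ p
      exact (odd_ncard_supp_iff p).1 hc
    · rintro _ ⟨v, hv, rfl⟩
      have hsingle : componentVertices (componentOf _ _ v) ∩
          (X ∪ inCopy X ⁻¹' U ∪ outCopy X ⁻¹' U) = {v} :=
        Set.eq_singleton_iff_unique_mem.2 ⟨⟨rfl, Or.inr hv.2⟩,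
          fun w hw => eq_of_componentOf_eq_of_mem_inter hv hw.1.symm⟩
      simp only [Set.mem_ofPred_eq, hsingle, Set.ncard_singleton, odd_one]
  · rw [Set.disjoint_left]
    rintro _ ⟨c, -, rfl⟩ ⟨v, hv, h⟩
    induction c using SimpleGraph.ConnectedComponent.ind with | _ p
    exact splitComponent_ne_componentOf p hv h.symm

theorem ncard_oddComponents_splitGraph_add_le [Finite V] {k : ℕ}
    (hk : ∀ S T : Set V, X ∩ S = X ∩ T →
      k ≤ (S ∩ T).ncard +
        ∑ᶠ C : Quiver.WeaklyConnectedComponent (deleteInOut S T),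
          ((componentVertices C ∩ (X ∪ S ∪ T)).ncard / 2)) (U : Set (SplitVertex X)) :
    ((splitGraph X).induce Uᶜ).oddComponents.ncard + 2 * k ≤ U.ncard + X.ncard := by
  have hX := inter_preimage_inCopy U
  have hodd := ncard_oddComponents_add_ncard_inter_le (U := U)
  have hhalf := two_mul_finsum_half_add_ncard_odd
    (componentOf (inCopy X ⁻¹' U) (outCopy X ⁻¹' U)) (X ∪ inCopy X ⁻¹' U ∪ outCopy X ⁻¹' U)
  have hunion := ncard_inter_add_ncard_union hX
  rw [← ncard_eq_ncard_outCopy_add_ncard_inCopy] at hunion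
  have hkU := hk _ _ hX
  change 2 * (∑ᶠ C, (componentVertices C ∩ _).ncard / 2) +
    {C | Odd (componentVertices C ∩ _).ncard}.ncard = _ at hhalf
  omega

end Tutte

end DirMultigraph

theorem corollary5p1 {V : Type*} [Finite V] [Quiver V] (X : Set V) (k : ℕ) :
    (∃ P : Fin k → DirMultigraph.XPath X,
      Pairwise fun i j => Disjoint (P i).vertexSet (P j).vertexSet) ↔
    ∀ S T : Set V, X ∩ S = X ∩ T →
      k ≤ (S ∩ T).ncard +
        ∑ᶠ C : Quiver.WeaklyConnectedComponent (DirMultigraph.deleteInOut S T),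
          ((DirMultigraph.componentVertices C ∩ (X ∪ S ∪ T)).ncard / 2) := by
  constructor
  · rintro ⟨P, hP⟩ S T hX
    exact (Nat.card_fin k).symm.trans_le <| DirMultigraph.card_le_of_pairwiseDisjoint hP fun i =>
      (P i).inter_nonempty_or_exists_nontrivial hX
  · intro hk
    have hodd := DirMultigraph.ncard_oddComponents_splitGraph_add_le hk
    have hXk : 2 * k ≤ X.ncard := by
      simpa using (Nat.le_add_left _ _).trans (hodd ∅)
    obtain ⟨M, hM, hMd⟩ := DirMultigraph.exists_isMatching_of_ncard_oddComponents_le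
      (G := DirMultigraph.splitGraph X) (X.ncard - 2 * k) fun U => by
        have := hodd U
        omega
    exact DirMultigraph.exists_disjoint_xPaths_of_isMatching hM (by omega)
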